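/- Let $A$ be an alphabet of $m$ letters, and let $\diamond\notin A$ be the hole character. A partial word of length $n$ over $A$ is a sequence of $n$ characters from $A\cup\{\diamond\}$; its hole density is the number of its holes divided by $n$. Write $u\subset v$ if the partial words $u,v$ have equal length and $u$ is obtained from $v$ by replacing some (possibly no) letters with $\diamond$. Let $p$ be a pattern, i.e. a finite word over an alphabet of variables. Suppose that $p$ uses $r$ distinct variables, where the $j$th variable occurs $k_j\ge 1$ times, ordered so that $1=k_1=\cdots=k_s<k_{s+1}\le\cdots\le k_r$ (thus $s$ is the number of variables that occur exactly once in $p$). An occurrence of $p$ in a partial word $w$ is a pair $(i,h)$, where $i$ is a position in $w$ and $h$ assigns to every variable of $p$ a nonempty partial word over $A$, such that the factor $f$ of $w$ of length $|h(p)|$ that starts at position $i$ satisfies $f\subset h(p)$, and such that $h$ is minimal with this property: no letter of an $h(x)$ is replaced with $\diamond$ in all the instances of the variable $x$ in $f$ (such a letter is regarded as a $\diamond$ of $h(x)$). Assume that $m\ge 2$, or that $m=1$ and no variable is repeated in $p$ (so that $s=r$). Let $d\in\mathbb Q\cap(0,1)$. For $n\ge 1$ with $dn\in\mathbb Z$ let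 $\widehat\Omega_{n,d}$ be the mean number of occurrences of $p$ in a partial word chosen uniformly among all partial words of length $n$ over $A$ with hole density $d$. Then, as $n\to\infty$ through the integers with $dn\in\mathbb Z$, $$\widehat{\Omega}_{n,d}\sim\frac{n^{s+1}}{(s+1)!}\prod_{j=s+1}^r\frac{Q_j}{m^{k_j-1}-Q_j},\qquad Q_j=[1+d(m-1)]^{k_j}-\left(1-\frac1m\right)(md)^{k_j}.$$ -/

import Mathlib

open Filter Asymptotics
open scoped Nat

/-! A partial word over the alphabet `A` is a sequence with entries in `Option A`; the entry `none`
is the hole `◇`, and `some a` is the letter `a`. -/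

namespace PartialWord

/-- `Contained u v`: the partial words `u` and `v` have the same length and `u` is obtained from `v`
by replacing some (possibly no) letters with holes. If `v` is a full word, this says exactly that
`u` and `v` are compatible, i.e. agree wherever `u` has a letter. -/
def Contained {A : Type*} (u v : List (Option A)) : Prop :=
  List.Forall₂ (fun a b => a = none ∨ a = b) u v

/-- A substitution for the pattern `p` assigns a partial word to every variable of `p`. -/
abbrev Subst {V : Type*} (p : List V) (A : Type*) : Type _ :=
  {v : V // v ∈ p} → List (Option A)

/-- The image `h(p)` of the pattern `p`: the concatenation of the images of its variables. -/
def Subst.image {V A : Type*} {p : List V} (h : Subst p A) : List (Option A) :=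
  p.attach.flatMap h

/-- `Matches h f`: `h` is nonerasing, `f` is obtained from `h(p)` by replacing some letters with
holes, and `h` is minimal (under containment) with this property, that is, a letter of some `h(v)`
may not be replaced with a hole in every instance of `v` (such a letter is treated as a hole
of `h(v)`). In particular, if `f` is a full word then `h(v)` is full for all `v` and `h(p) = f`. -/
def Matches {V A : Type*} {p : List V} (h : Subst p A) (f : List (Option A)) : Prop :=
  (∀ v, h v ≠ []) ∧ Contained f h.image ∧
    ∀ g : Subst p A, (∀ v, Contained (g v) (h v)) → Contained f g.image → g = h

/-- The occurrences of `p` in the partial word `w`: pairs of a starting position `i` and a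
substitution `h` that matches a factor `f` of `w` starting at position `i`. -/
def occurrences {V A : Type*} (p : List V) (w : List (Option A)) : Set (ℕ × Subst p A) :=
  {q | ∃ x f y, w = x ++ f ++ y ∧ x.length = q.1 ∧ Matches q.2 f}

/-- The cardinality of the set of occurrences is a genuine one: the set is finite. -/
theorem occurrences_finite {V A : Type*} [Finite A] (p : List V) (w : List (Option A)) :
    (occurrences p w).Finite := by
  have : Finite {v : V // v ∈ p} := List.finite_toSet p |>.to_subtype
  have h1 : (Set.univ.pi (fun _ : {v : V // v ∈ p} => {l : List (Option A) | l.length ≤ w.length})).Finite :=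
    Set.Finite.pi' (fun _ => List.finite_length_le (Option A) w.length) |>.subset (fun f hf v => hf v trivial)
  refine ((Set.finite_Iic w.length).prod h1).subset ?_
  rintro ⟨i, h⟩ ⟨x, f, y, hw, hx, -, hc, -⟩
  have hl := hc.length_eq
  subst hw
  refine ⟨by simp at hx ⊢; omega, fun v _ => ?_⟩
  have hs : (h v).Sublist (Subst.image h) := by
    have := List.sublist_flatten_of_mem (List.mem_map_of_mem (f := h) (List.mem_attach p v))
    simpa [Subst.image, List.flatMap] using this
  have hs2 := hs.length_le
  show (h v).length ≤ (x ++ f ++ y).length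
  simp only [List.length_append]
  simp only at hl
  omega

/-- The number of holes. -/
def holes {A : Type*} {n : ℕ} (w : Fin n → Option A) : ℕ :=
  (Finset.univ.filter fun i => (w i).isNone).card

/-- The partial words of length `n` over `A` with hole density `d`. -/
def withDensity (A : Type*) [Fintype A] (n : ℕ) (d : ℚ) : Finset (Fin n → Option A) :=
  Finset.univ.filter fun w => (holes w : ℚ) / n = d

/-- The mean number of occurrences of `p` in a partial word of length `n` over `A` with hole
density `d`, all such words being equally likely. -/
noncomputable def meanOccurrences {V : Type*} (p : List V) (A : Type*) [Fintype A]
    (n : ℕ) (d : ℚ) : ℝ :=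
  (∑ w ∈ withDensity A n d, ((occurrences p (List.ofFn w)).ncard : ℝ)) /
    (withDensity A n d).card

/-- `Q = [1 + d(m-1)]^k - (1 - 1/m)(md)^k`. -/
noncomputable def Q (m : ℕ) (d : ℝ) (k : ℕ) : ℝ :=
  (1 + d * ((m : ℝ) - 1)) ^ k - (1 - 1 / (m : ℝ)) * ((m : ℝ) * d) ^ k

end PartialWord

/-!
An occurrence of the pattern is determined by its position and the lengths of the images: label the
characters of the factor by pairs (variable, position in its image); the factor is an instance
exactly when characters with a common label are compatible, and minimality then determines the
images. Labels of unrepeated variables impose no condition, so the probability that a position and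
a choice of lengths give an occurrence depends only on the lengths `l` of the repeated variables,
whereas the position and the remaining lengths can be chosen in `(n + 1 - L).choose (s + 1)` ways,
where `L` is the number of characters taken up by the repeated variables.

For fixed `l`, as `n → ∞` the `L` characters behave like independent ones, which are holes with
probability `d` and otherwise uniform letters, so that the probability tends to `∏ j, q j ^ l j`
with `q j = Q_j / m ^ (k_j - 1)`. Summing over `l` gives the product of geometric series
`∏ j, q j / (1 - q j)`. The sum and the limit can be exchanged by dominated convergence: for
`L ≤ n`, the probability only grows if all but `l j / N` of the labels of each variable are
forgotten, and for the at most `n / N` characters that remain, passing from hypergeometric to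
independent characters costs a factor of at most `N / (N - 1)` each, which is harmless for large
`N`.
-/

namespace PartialWord

/-- Two characters are compatible if they are equal unless one of them is a hole. -/
def Compatible {A : Type*} (a b : Option A) : Prop :=
  a = none ∨ b = none ∨ a = b

theorem Compatible.refl {A : Type*} (a : Option A) : Compatible a a := Or.inr (Or.inr rfl)

theorem Compatible.of_forall_eq_none_or_eq {A : Type*} {a b c : Option A}
    (ha : a = none ∨ a = c) (hb : b = none ∨ b = c) : Compatible a b := by
  unfold Compatible
  grind

/-- `LabelCompatible f L`: if the `j`-th character of `f` carries the `j`-th label of `L`, then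
characters with the same label are compatible. Only as many characters as there are labels
matter. -/
def LabelCompatible {A β : Type*} (f : List (Option A)) (L : List β) : Prop :=
  ∀ x a b, (a, x) ∈ f.zip L → (b, x) ∈ f.zip L → Compatible a b

theorem LabelCompatible.exists_join {A β : Type*} {f : List (Option A)} {L : List β}
    (hf : LabelCompatible f L) :
    ∃ χ : β → Option A, (∀ a x, (a, x) ∈ f.zip L → a = none ∨ a = χ x) ∧
      ∀ a x, χ x = some a → (some a, x) ∈ f.zip L := by
  have join_at (x : β) : ∃ o : Option A, (∀ a, (a, x) ∈ f.zip L → a = none ∨ a = o) ∧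
      ∀ a, o = some a → (some a, x) ∈ f.zip L := by
    by_cases h : ∃ a, (some a, x) ∈ f.zip L
    · obtain ⟨a, ha⟩ := h
      refine ⟨some a, fun b hb => ?_, by rintro _ ⟨⟩; exact ha⟩
      have := hf x b (some a) hb ha
      simpa [Compatible] using this
    · refine ⟨none, fun b hb => ?_, by simp⟩
      cases b with
      | none => simp
      | some b => exact absurd ⟨b, hb⟩ h
  choose χ hχ using join_at
  exact ⟨χ, fun a x => (hχ x).1 a, fun a x => (hχ x).2 a⟩

theorem labelCompatible_take_iff {A β : Type*} {f : List (Option A)} {L : List β} :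
    LabelCompatible (f.take L.length) L ↔ LabelCompatible f L := by
  have : (f.take L.length).zip L = f.zip L := by
    induction f generalizing L with
    | nil => rw [List.take_nil]
    | cons a f ih => cases L <;> simp [ih]
  rw [LabelCompatible, LabelCompatible, this]

theorem labelCompatible_drop_ofFn_iff {A β : Type*} {n i : ℕ} {w : Fin n → Option A} {L : List β}
    (hi : i + L.length ≤ n) :
    LabelCompatible ((List.ofFn w).drop i) L ↔ ∀ j j', L.get j = L.get j' →
      Compatible (w (Fin.castLE hi (Fin.natAdd i j))) (w (Fin.castLE hi (Fin.natAdd i j'))) := by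
  have mem_zip (a x) : (a, x) ∈ ((List.ofFn w).drop i).zip L ↔
      ∃ j, w (Fin.castLE hi (Fin.natAdd i j)) = a ∧ L.get j = x := by
    simp only [List.mem_iff_getElem, List.getElem_zip, List.getElem_drop, List.getElem_ofFn,
      Prod.mk.injEq, List.length_zip, List.length_drop, List.length_ofFn]
    exact ⟨fun ⟨j, hj, h⟩ => ⟨⟨j, by omega⟩, h⟩, fun ⟨j, h⟩ => ⟨j, by omega, h⟩⟩
  simp only [LabelCompatible, mem_zip]
  exact ⟨fun h j j' hj => h _ _ _ ⟨j, rfl, hj⟩ ⟨j', rfl, rfl⟩,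
    fun h x a b ⟨j, ha, hj⟩ ⟨j', hb, hj'⟩ => ha ▸ hb ▸ h j j' (hj.trans hj'.symm)⟩

section Labels

variable {W : Type*}

/-- The positions of a concatenation of blocks, one for each entry of `q`, where the block of `v`
has length `l v`: the label `(v, c)` stands for the `c`-th position of a block of `v`. -/
def labels (q : List W) (l : W → ℕ) : List (W × ℕ) :=
  q.flatMap fun v => (List.range (l v)).map (v, ·)

theorem mem_labels {q : List W} {l : W → ℕ} {x : W × ℕ} :
    x ∈ labels q l ↔ x.1 ∈ q ∧ x.2 < l x.1 := by
  obtain ⟨v, c⟩ := x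
  simp only [labels, List.mem_flatMap, List.mem_map, List.mem_range]
  grind

theorem length_labels [Fintype W] [DecidableEq W] (q : List W) (l : W → ℕ) :
    (labels q l).length = ∑ v, q.count v * l v := by
  simp only [labels, List.length_flatMap, List.length_map, List.length_range]
  rw [Finset.sum_list_map_count, ← Finset.sum_subset (Finset.subset_univ q.toFinset)]
  · simp only [smul_eq_mul]
  · simp +contextual [List.count_eq_zero]

theorem count_labels [DecidableEq W] (q : List W) {l : W → ℕ} {x : W × ℕ} (hx : x.2 < l x.1) :
    (labels q l).count x = q.count x.1 := by
  obtain ⟨v, c⟩ := x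
  have count_block (u : W) :
      ((List.range (l u)).map (u, ·)).count (v, c) = if u = v then 1 else 0 := by
    rw [List.Nodup.count (List.nodup_range.map (Prod.mk_right_injective u))]
    refine if_congr ?_ rfl rfl
    simp only [List.mem_map, List.mem_range, Prod.mk.injEq]
    exact ⟨fun ⟨_, _, huv, _⟩ => huv, fun huv => ⟨c, huv ▸ hx, huv, rfl⟩⟩
  simp only [labels, List.count_flatMap, Function.comp_def, count_block]
  induction q with
  | nil => rfl
  | cons u q ih => simp [ih, List.count_cons, add_comm]

end Labels

namespace Subst

variable {V A : Type*} {p : List V}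

/-- The character of `h` at the label `(v, c)`, that is, the `c`-th character of `h v`. It is a hole
if `h v` is too short. -/
def char (h : Subst p A) (x : {v // v ∈ p} × ℕ) : Option A :=
  (h x.1).getD x.2 none

/-- The labels of the positions of the image of `h`. -/
abbrev imageLabels (h : Subst p A) : List ({v // v ∈ p} × ℕ) :=
  labels p.attach fun v => (h v).length

/-- The substitution whose images have the lengths `l` and the characters `χ`. -/
def ofChar (l : {v // v ∈ p} → ℕ) (χ : {v // v ∈ p} × ℕ → Option A) : Subst p A :=
  fun v => (List.range (l v)).map fun c => χ (v, c)

theorem length_ofChar (l : {v // v ∈ p} → ℕ) (χ : {v // v ∈ p} × ℕ → Option A) (v : {v // v ∈ p}) :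
    (ofChar l χ v).length = l v := by
  simp [ofChar]

theorem char_ofChar (l : {v // v ∈ p} → ℕ) (χ : {v // v ∈ p} × ℕ → Option A)
    (x : {v // v ∈ p} × ℕ) : (ofChar l χ).char x = if x.2 < l x.1 then χ x else none := by
  split_ifs with hx <;> simp [char, ofChar, List.getD, hx]

theorem ext_char {g h : Subst p A} (hlen : ∀ v, (g v).length = (h v).length)
    (hchar : ∀ x, g.char x = h.char x) : g = h := by
  funext v
  refine List.ext_getElem (hlen v) fun c hg hh => ?_
  simpa [char, hg, hh] using hchar (v, c)

theorem imageLabels_congr {g h : Subst p A} (hlen : ∀ v, (g v).length = (h v).length) :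
    g.imageLabels = h.imageLabels := by
  simp only [imageLabels, hlen]

theorem image_eq_map_labels (h : Subst p A) : h.image = h.imageLabels.map h.char := by
  rw [image, imageLabels, labels, List.map_flatMap]
  refine List.flatMap_congr fun v _ => List.ext_getElem (by simp) fun c hc _ => ?_
  simp [char, hc]

end Subst

section Matches

variable {V A : Type*} {p : List V}

theorem contained_image_iff {h : Subst p A} {f : List (Option A)} :
    Contained f h.image ↔ f.length = h.imageLabels.length ∧
      ∀ a x, (a, x) ∈ f.zip h.imageLabels → a = none ∨ a = h.char x := by
  rw [Contained, h.image_eq_map_labels, List.forall₂_map_right_iff, List.forall₂_iff_zip]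

theorem forall_contained_iff {g h : Subst p A} :
    (∀ v, Contained (g v) (h v)) ↔ (∀ v, (g v).length = (h v).length) ∧
      ∀ x, g.char x = none ∨ g.char x = h.char x := by
  simp only [Contained, List.forall₂_iff_get, forall_and, Prod.forall, Subst.char]
  refine and_congr_right fun hlen => forall_congr' fun v =>
    ⟨fun hget c => ?_, fun hchar c hg hh => ?_⟩
  · by_cases hc : c < (g v).length
    · simpa [hc, hlen v ▸ hc] using hget c hc (hlen v ▸ hc)
    · simp [hc]
  · simpa [hg, hh] using hchar c

/-- Minimality of `h` means that every letter of `h` is witnessed by an equal letter of `f`. -/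
theorem matches_iff {h : Subst p A} {f : List (Option A)} :
    Matches h f ↔ (∀ v, h v ≠ []) ∧ Contained f h.image ∧
      ∀ a x, h.char x = some a → (some a, x) ∈ f.zip h.imageLabels := by
  classical
  refine and_congr_right fun _ => and_congr_right fun hf => ⟨fun hmin a x hx => ?_, ?_⟩
  · by_contra hax
    let g : Subst p A := .ofChar (fun v => (h v).length) (Function.update h.char x none)
    have hlen (v) : (g v).length = (h v).length := Subst.length_ofChar _ _ v
    have g_le_h : ∀ v, Contained (g v) (h v) := by
      refine forall_contained_iff.2 ⟨hlen, fun y => ?_⟩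
      rw [Subst.char_ofChar]
      grind
    have f_le_g : Contained f g.image := by
      rw [contained_image_iff, Subst.imageLabels_congr hlen] at *
      refine ⟨hf.1, fun b y hby => ?_⟩
      rw [Subst.char_ofChar, if_pos (mem_labels.1 (List.of_mem_zip hby).2).2]
      have := hf.2 b y hby
      grind
    have hg : g.char x = none := by simp [g, Subst.char_ofChar]
    simp [← hmin g g_le_h f_le_g, hg] at hx
  · intro hwit g g_le_h f_le_g
    obtain ⟨hlen, hchar⟩ := forall_contained_iff.1 g_le_h
    rw [contained_image_iff, Subst.imageLabels_congr hlen] at f_le_g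
    refine Subst.ext_char hlen fun x => ?_
    have := hchar x
    cases hx : h.char x with
    | none => grind
    | some a => simpa [eq_comm] using f_le_g.2 _ x (hwit a x hx)

theorem Matches.eq_of_length_eq {g h : Subst p A} {f : List (Option A)} (hg : Matches g f)
    (hh : Matches h f) (hlen : ∀ v, (g v).length = (h v).length) : g = h := by
  simp only [matches_iff, contained_image_iff, Subst.imageLabels_congr hlen] at hg hh
  refine Subst.ext_char hlen fun x => Option.ext fun a => ⟨fun ha => ?_, fun ha => ?_⟩
  · simpa [eq_comm] using hh.2.1.2 _ x (hg.2.2 a x ha)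
  · simpa [eq_comm] using hg.2.1.2 _ x (hh.2.2 a x ha)

theorem Matches.labelCompatible {h : Subst p A} {f : List (Option A)} (hf : Matches h f) :
    LabelCompatible f h.imageLabels := fun x a b ha hb =>
  have hchar := (contained_image_iff.1 hf.2.1).2
  .of_forall_eq_none_or_eq (hchar a x ha) (hchar b x hb)

theorem exists_matches {l : {v // v ∈ p} → ℕ} {f : List (Option A)} (hl : ∀ v, 0 < l v)
    (hlen : f.length = (labels p.attach l).length) (hf : LabelCompatible f (labels p.attach l)) :
    ∃ h : Subst p A, (∀ v, (h v).length = l v) ∧ Matches h f := by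
  obtain ⟨χ, hχ, hwit⟩ := hf.exists_join
  have hlabels : (Subst.ofChar l χ).imageLabels = labels p.attach l := by
    simp only [Subst.imageLabels, Subst.length_ofChar]
  refine ⟨.ofChar l χ, Subst.length_ofChar l χ, matches_iff.2 ⟨fun v => ?_, ?_, fun a x hx => ?_⟩⟩
  · exact List.ne_nil_of_length_pos (Subst.length_ofChar l χ v ▸ hl v)
  · rw [contained_image_iff, hlabels]
    refine ⟨hlen, fun a x hax => ?_⟩
    rw [Subst.char_ofChar, if_pos (mem_labels.1 (List.of_mem_zip hax).2).2]
    exact hχ a x hax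
  · rw [hlabels]
    refine hwit a x ?_
    rw [Subst.char_ofChar] at hx
    grind

theorem mem_occurrences_iff {w : List (Option A)} {i : ℕ} {h : Subst p A} :
    (i, h) ∈ occurrences p w ↔ i + h.imageLabels.length ≤ w.length ∧
      Matches h ((w.drop i).take h.imageLabels.length) := by
  constructor
  · rintro ⟨x, f, y, rfl, rfl, hf⟩
    have hlen := (contained_image_iff.1 hf.2.1).1
    simp only [List.length_append, List.append_assoc, List.drop_left, ← hlen, List.take_left]
    exact ⟨by omega, hf⟩
  · rintro ⟨hi, hh⟩
    refine ⟨w.take i, _, (w.drop i).drop h.imageLabels.length, ?_, ?_, hh⟩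
    · rw [List.append_assoc, List.take_append_drop, List.take_append_drop]
    · exact List.length_take_of_le (by omega)

/-- An occurrence is determined by its position and by the lengths of the images of the variables,
written as `l v + 1` since they are positive. -/
theorem ncard_occurrences (p : List V) (w : List (Option A)) :
    (occurrences p w).ncard = {z : ℕ × ({v // v ∈ p} → ℕ) |
      z.1 + (labels p.attach fun v => z.2 v + 1).length ≤ w.length ∧
        LabelCompatible (w.drop z.1) (labels p.attach fun v => z.2 v + 1)}.ncard := by
  have length_pos {i : ℕ} {h : Subst p A} (hz : (i, h) ∈ occurrences p w) (v) :
      (h v).length - 1 + 1 = (h v).length :=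
    Nat.sub_add_cancel (List.length_pos_of_ne_nil ((mem_occurrences_iff.1 hz).2.1 v))
  have inj : Set.InjOn (fun z : ℕ × Subst p A => (z.1, fun v => (z.2 v).length - 1))
      (occurrences p w) := by
    rintro ⟨i, g⟩ hg ⟨j, h⟩ hh hgh
    obtain ⟨rfl, hlen⟩ := Prod.mk.inj hgh
    replace hlen (v) : (g v).length = (h v).length := by
      rw [← length_pos hg, ← length_pos hh, congrFun hlen v]
    have hg' := (mem_occurrences_iff.1 hg).2
    rw [Subst.imageLabels_congr hlen] at hg'
    rw [hg'.eq_of_length_eq (mem_occurrences_iff.1 hh).2 hlen]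
  rw [← inj.ncard_image]
  congr 1
  ext ⟨i, l⟩
  constructor
  · rintro ⟨⟨j, h⟩, hz, hjl⟩
    obtain ⟨rfl, rfl⟩ := Prod.mk.inj hjl
    simp only [Set.mem_ofPred_eq, length_pos hz]
    have := mem_occurrences_iff.1 hz
    exact ⟨this.1, labelCompatible_take_iff.1 this.2.labelCompatible⟩
  · rintro ⟨hi, hl⟩
    have hw := List.length_take_of_le (List.length_drop ▸ Nat.le_sub_of_add_le' hi)
    obtain ⟨h, hlen, hh⟩ := exists_matches (l := fun v => l v + 1) (fun v => Nat.succ_pos (l v))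
      hw (labelCompatible_take_iff.2 hl)
    refine ⟨(i, h), mem_occurrences_iff.2 ?_, by simp [hlen]⟩
    simpa only [Subst.imageLabels, hlen] using ⟨hi, hh⟩

end Matches

section Counting

variable {S T A : Type*} [Fintype S] [Fintype T] [Fintype A]

/-- The number of holes of a partial word whose positions form an arbitrary finite type. -/
def numHoles {S A : Type*} [Fintype S] (u : S → Option A) : ℕ :=
  (Finset.univ.filter fun i => (u i).isNone).card

theorem numHoles_le_card {S A : Type*} [Fintype S] (u : S → Option A) :
    numHoles u ≤ Fintype.card S :=
  Finset.card_le_univ _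

theorem prod_elim_eq_pow_numHoles {S A R : Type*} [Fintype S] [CommSemiring R] (x y : R)
    (u : S → Option A) :
    ∏ i, (u i).elim x (fun _ => y) = x ^ numHoles u * y ^ (Fintype.card S - numHoles u) := by
  classical
  have elim_eq (o : Option A) : o.elim x (fun _ => y) = if o.isNone then x else y := by
    cases o <;> rfl
  simp only [elim_eq, Finset.prod_ite, Finset.prod_const, Finset.filter_not,
    Finset.card_sdiff_of_subset (Finset.filter_subset _ _), Finset.card_univ, numHoles]

/-- The partial words with `K` holes whose positions form the type `T`. -/
def withNumHoles (T A : Type*) [Fintype T] [DecidableEq T] [Fintype A] (K : ℕ) :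
    Finset (T → Option A) :=
  Finset.univ.filter fun w => numHoles w = K

variable [DecidableEq T]

open Polynomial in
/-- The generating function of the words extending `u`, where `X` marks the holes, is
`X ^ numHoles u * (X + card A) ^ (card T - card S)`. -/
theorem card_filter_withNumHoles_comp_eq [DecidableEq A] {f : S → T} (hf : f.Injective)
    (u : S → Option A) (K : ℕ) :
    ((withNumHoles T A K).filter fun w => w ∘ f = u).card =
      (X ^ numHoles u *
        (X + C (Fintype.card A)) ^ (Fintype.card T - Fintype.card S) : ℕ[X]).coeff K := by
  classical
  let fiber (t : T) : Finset (Option A) := Finset.univ.filter fun o => ∀ s, f s = t → o = u s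
  let weight (o : Option A) : ℕ[X] := o.elim X fun _ => 1
  have sum_fiber (t : T) (ht : t ∉ Finset.univ.image f) :
      ∑ o ∈ fiber t, weight o = X + C (Fintype.card A) := by
    have : fiber t = Finset.univ := by
      simp only [Finset.mem_image, Finset.mem_univ, true_and, not_exists] at ht
      simp [fiber, ht]
    simp [this, weight, Fintype.sum_option]
  have sum_fiber_apply (s : S) : ∑ o ∈ fiber (f s), weight o = weight (u s) := by
    have : fiber (f s) = {u s} := by
      ext o
      simp [fiber, hf.eq_iff]
    rw [this, Finset.sum_singleton]
  have hset : (withNumHoles T A K).filter (fun w => w ∘ f = u) =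
      (Fintype.piFinset fiber).filter fun w => numHoles w = K := by
    ext w
    simp only [withNumHoles, fiber, Finset.mem_filter, Finset.mem_univ, true_and,
      Fintype.mem_piFinset, funext_iff, Function.comp_apply, and_comm (a := numHoles w = K)]
    exact and_congr_left' ⟨fun h _ s hs => hs ▸ h s, fun h s => h _ s rfl⟩
  calc
    _ = (∑ w ∈ Fintype.piFinset fiber, ∏ t, weight (w t)).coeff K := by
      simp only [hset, weight, prod_elim_eq_pow_numHoles, one_pow, mul_one, finsetSum_coeff,
        coeff_X_pow, eq_comm (a := K), Finset.card_filter]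
    _ = _ := by
      rw [← Finset.prod_univ_sum, ← Finset.prod_mul_prod_compl (Finset.univ.image f),
        Finset.prod_image hf.injOn]
      simp only [sum_fiber_apply, weight, prod_elim_eq_pow_numHoles, one_pow, mul_one]
      rw [Finset.prod_congr rfl fun t ht => sum_fiber t (Finset.mem_compl.1 ht),
        Finset.prod_const, Finset.card_compl, Finset.card_image_of_injective _ hf, Finset.card_univ]

theorem card_withNumHoles (K : ℕ) : (withNumHoles T A K).card =
    (Fintype.card T).choose K * Fintype.card A ^ (Fintype.card T - K) := by
  classical
  have := card_filter_withNumHoles_comp_eq (T := T) (A := A)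
    (Function.injective_of_subsingleton Empty.elim) Empty.elim K
  simpa [Subsingleton.elim _ (Empty.elim : Empty → Option A), numHoles, mul_comm, -map_natCast,
    -eq_natCast, Polynomial.coeff_X_add_C_pow] using this

theorem choose_mul_descFactorial (n : ℕ) {K h : ℕ} (hh : h ≤ K) :
    n.choose K * K.descFactorial h = n.descFactorial h * (n - h).choose (K - h) := by
  rw [Nat.descFactorial_eq_factorial_mul_choose, Nat.descFactorial_eq_factorial_mul_choose,
    mul_left_comm, Nat.choose_mul hh, mul_assoc]

theorem choose_mul_descFactorial_sub {n K g : ℕ} (hK : K ≤ n) (hg : g ≤ n) :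
    n.choose K * (n - K).descFactorial g = n.descFactorial g * (n - g).choose K := by
  rcases le_or_gt g (n - K) with h | h
  · rw [← Nat.choose_symm hK, choose_mul_descFactorial n h,
      ← Nat.choose_symm (by omega : K ≤ n - g)]
    congr 2
    omega
  · rw [Nat.descFactorial_eq_zero_iff_lt.2 h, mul_zero,
      Nat.choose_eq_zero_of_lt (show n - g < K by omega), mul_zero]

/-- The probability that `h` given positions carry holes and `g` other given positions carry given
letters, in a random word of length `n` with `K` holes over an alphabet of `m` letters. -/
noncomputable def patternProb (m n K h g : ℕ) : ℝ :=
  K.descFactorial h * (n - K).descFactorial g / (n.descFactorial (h + g) * (m : ℝ) ^ g)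

theorem patternProb_nonneg (m n K h g : ℕ) : 0 ≤ patternProb m n K h g := by
  unfold patternProb
  positivity

theorem choose_mul_patternProb {m n K h g : ℕ} (hm : 0 < m) (hK : K ≤ n) (hh : h ≤ K)
    (hn : h + g ≤ n) :
    n.choose K * (m : ℝ) ^ (n - K) * patternProb m n K h g =
      (n - (h + g)).choose (K - h) * (m : ℝ) ^ (n - (h + g) - (K - h)) := by
  have count : n.choose K * (K.descFactorial h * (n - K).descFactorial g) =
      n.descFactorial (h + g) * (n - (h + g)).choose (K - h) := by
    have := choose_mul_descFactorial_sub (n := n - h) (K := K - h) (g := g) (by omega) (by omega)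
    rw [show n - h - (K - h) = n - K by omega, Nat.sub_sub] at this
    rw [← mul_assoc, choose_mul_descFactorial n hh, mul_assoc, this, ← mul_assoc,
      mul_comm (n.descFactorial h), ← Nat.descFactorial_mul_descFactorial (Nat.le_add_right h g),
      Nat.add_sub_cancel_left]
  rcases le_or_gt g (n - K) with hg | hg
  · have hpos : (0 : ℝ) < n.descFactorial (h + g) := by
      exact_mod_cast Nat.descFactorial_pos.2 hn
    have hpow : (m : ℝ) ^ (n - K) = m ^ (n - (h + g) - (K - h)) * m ^ g := by
      rw [← pow_add]
      congr 1
      omega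
    rw [patternProb, hpow]
    field_simp
    rw [mul_assoc]
    exact_mod_cast count
  · rw [patternProb, Nat.descFactorial_eq_zero_iff_lt.2 hg,
      Nat.choose_eq_zero_of_lt (show n - (h + g) < K - h by omega)]
    simp

theorem card_filter_withNumHoles_comp_eq_mul [DecidableEq A] [Nonempty A] {f : S → T}
    (hf : f.Injective) (u : S → Option A) {K : ℕ} (hK : K ≤ Fintype.card T) :
    (((withNumHoles T A K).filter fun w => w ∘ f = u).card : ℝ) =
      (withNumHoles T A K).card * patternProb (Fintype.card A) (Fintype.card T) K (numHoles u)
        (Fintype.card S - numHoles u) := by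
  have hST := Fintype.card_le_of_injective f hf
  have hu := numHoles_le_card u
  rw [card_filter_withNumHoles_comp_eq hf, card_withNumHoles, Polynomial.coeff_X_pow_mul']
  push_cast
  split_ifs with h
  · rw [choose_mul_patternProb Fintype.card_pos hK h (by omega), Polynomial.coeff_X_add_C_pow,
      Nat.add_sub_cancel' hu, mul_comm]
    push_cast
    rfl
  · rw [patternProb, Nat.descFactorial_eq_zero_iff_lt.2 (not_le.1 h)]
    simp

open Classical in
theorem card_filter_withNumHoles_comp [Nonempty A] {f : S → T} (hf : f.Injective)
    (E : (S → Option A) → Prop) {K : ℕ} (hK : K ≤ Fintype.card T) :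
    (((withNumHoles T A K).filter fun w => E (w ∘ f)).card : ℝ) =
      (withNumHoles T A K).card * ∑ u : S → Option A with E u,
        patternProb (Fintype.card A) (Fintype.card T) K (numHoles u)
          (Fintype.card S - numHoles u) := by
  rw [Finset.mul_sum, Finset.card_eq_sum_card_fiberwise (f := (· ∘ f))
    (t := Finset.univ.filter E) (fun w hw => by simpa using (Finset.mem_filter.1 hw).2)]
  push_cast
  refine Finset.sum_congr rfl fun u hu => ?_
  rw [← card_filter_withNumHoles_comp_eq_mul hf u hK, Finset.filter_filter]
  congr 2
  refine Finset.filter_congr fun w _ => and_iff_right_of_imp ?_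
  rintro rfl
  exact (Finset.mem_filter.1 hu).2

end Counting

section Columns

variable {A C : Type*}

/-- The cells of a family of columns, where the column `c` has `κ c` cells. -/
abbrev Cells (κ : C → ℕ) : Type _ :=
  Σ c, Fin (κ c)

/-- In every column, the characters are pairwise compatible. -/
def ColumnsCompatible {κ : C → ℕ} (u : Cells κ → Option A) : Prop :=
  ∀ c t t', Compatible (u ⟨c, t⟩) (u ⟨c, t'⟩)

/-- Labels that occur only once impose no condition, so that only the columns formed by the
positions with a common label `γ c` matter. -/
theorem exists_cells_embedding {J β : Type*} [Fintype J] [DecidableEq β] {lab : J → β} {γ : C → β}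
    {κ : C → ℕ} (hγ : γ.Injective)
    (hκ : ∀ c, (Finset.univ.filter fun j => lab j = γ c).card = κ c)
    (hunique : ∀ j j', lab j = lab j' → j = j' ∨ lab j ∈ Set.range γ) :
    ∃ e : Cells κ ↪ J, ∀ u : J → Option A,
      (∀ j j', lab j = lab j' → Compatible (u j) (u j')) ↔ ColumnsCompatible (u ∘ e) := by
  let column (c : C) : Fin (κ c) ≃ {j // lab j = γ c} :=
    (Fintype.equivFinOfCardEq ((Fintype.card_subtype _).trans (hκ c))).symm
  have lab_column (c t) : lab (column c t) = γ c := (column c t).2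
  refine ⟨⟨fun x => column x.1 x.2, ?_⟩, fun u =>
    ⟨fun hu c t t' => hu _ _ ?_, fun hu j j' hj => ?_⟩⟩
  · rintro ⟨c, t⟩ ⟨c', t'⟩ h
    obtain rfl : c = c' := hγ (lab_column c t ▸ lab_column c' t' ▸ congrArg lab h)
    exact congrArg _ ((column c).injective (Subtype.ext h))
  · exact (lab_column c t).trans (lab_column c t').symm
  · obtain rfl | ⟨c, hc⟩ := hunique j j' hj
    · exact .refl _
    · have hu_column (t t') : Compatible (u (column c t)) (u (column c t')) := hu c t t'
      simpa using hu_column ((column c).symm ⟨j, hc.symm⟩)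
        ((column c).symm ⟨j', (hc.trans hj).symm⟩)

open Classical in
/-- The probability that the columns are compatible, if their cells are filled with the characters
at distinct positions of a random word of length `n` with `K` holes over `A`. -/
noncomputable def compatProb (A : Type*) [Fintype A] [Fintype C] (n K : ℕ) (κ : C → ℕ) : ℝ :=
  ∑ u : Cells κ → Option A with ColumnsCompatible u,
    patternProb (Fintype.card A) n K (numHoles u) (Fintype.card (Cells κ) - numHoles u)

variable [Fintype A] [Fintype C] {κ : C → ℕ}

open Classical in
theorem card_filter_columnsCompatible [Nonempty A] {n K : ℕ} (hK : K ≤ n) {e : Cells κ → Fin n}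
    (he : e.Injective) :
    (((withNumHoles (Fin n) A K).filter fun w => ColumnsCompatible (w ∘ e)).card : ℝ) =
      (withNumHoles (Fin n) A K).card * compatProb A n K κ := by
  have := card_filter_withNumHoles_comp (A := A) he ColumnsCompatible
    (hK.trans_eq (Fintype.card_fin n).symm)
  rw [Fintype.card_fin] at this
  rw [compatProb]
  convert this

theorem compatProb_nonneg (n K : ℕ) : 0 ≤ compatProb A n K κ :=
  Finset.sum_nonneg fun _ _ => patternProb_nonneg _ _ _ _ _

theorem card_withNumHoles_fin_pos [Nonempty A] {n K : ℕ} (hK : K ≤ n) :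
    0 < (withNumHoles (Fin n) A K).card := by
  rw [card_withNumHoles, Fintype.card_fin]
  exact Nat.mul_pos (Nat.choose_pos hK) (Nat.pow_pos Fintype.card_pos)

theorem compatProb_le_comp [Nonempty A] {C' : Type*} [Fintype C'] {n K : ℕ} (hK : K ≤ n)
    (hn : Fintype.card (Cells κ) ≤ n) {ι : C' → C} (hι : ι.Injective) :
    compatProb A n K κ ≤ compatProb A n K (κ ∘ ι) := by
  classical
  obtain ⟨e⟩ : Nonempty (Cells κ ↪ Fin n) :=
    Function.Embedding.nonempty_of_card_le (by rwa [Fintype.card_fin])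
  let ι' : Cells (κ ∘ ι) ↪ Cells κ := ⟨Sigma.map ι fun _ t => t, hι.sigma_map fun _ _ _ h => h⟩
  have hpos : (0 : ℝ) < (withNumHoles (Fin n) A K).card :=
    Nat.cast_pos.2 (card_withNumHoles_fin_pos hK)
  refine le_of_mul_le_mul_left ?_ hpos
  rw [← card_filter_columnsCompatible hK e.injective,
    ← card_filter_columnsCompatible hK (ι'.trans e).injective]
  refine Nat.cast_le.2 (Finset.card_le_card (Finset.monotone_filter_right _ fun w _ hw => ?_))
  exact fun c t t' => hw (ι c) t t'

end Columns

section ColumnWeight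

variable {A R : Type*} [Fintype A] [CommRing R]

open Classical in
theorem sum_forall_eq_none_or_eq_some {T : Type*} [Fintype T] (u : T → Option A) :
    ∑ a : A, (if ∀ t, u t = none ∨ u t = some a then (1 : R) else 0) =
      (if ∀ t t', Compatible (u t) (u t') then 1 else 0) +
        if u = fun _ => none then (Fintype.card A - 1 : R) else 0 := by
  by_cases hu : u = fun _ => none
  · simp [hu, Compatible]
  · obtain ⟨t₀, ht₀⟩ := Function.ne_iff.1 hu
    obtain ⟨b, hb⟩ := Option.ne_none_iff_exists'.1 ht₀
    have forall_iff (a) : (∀ t, u t = none ∨ u t = some a) ↔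
        a = b ∧ ∀ t t', Compatible (u t) (u t') := by
      refine ⟨fun h => ⟨?_, fun t t' => .of_forall_eq_none_or_eq (h t) (h t')⟩, ?_⟩
      · simpa [hb, eq_comm] using h t₀
      · rintro ⟨rfl, h⟩ t
        simpa [Compatible, hb] using h t t₀
    simp only [forall_iff, hu, if_false, add_zero, ite_and]
    rw [Finset.sum_ite_eq' Finset.univ b, if_pos (Finset.mem_univ b)]

open Classical in
/-- Pairwise compatible characters all lie in some `{none, some a}`, where `a` is unique unless they
are all holes. -/
theorem sum_compatible_prod_elim {T : Type*} [Fintype T] (x y : R) :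
    ∑ u : T → Option A with ∀ t t', Compatible (u t) (u t'), ∏ t, (u t).elim x (fun _ => y) =
      Fintype.card A * (x + y) ^ Fintype.card T - (Fintype.card A - 1) * x ^ Fintype.card T := by
  have sum_words (a : A) : ∑ u : T → Option A with ∀ t, u t = none ∨ u t = some a,
      ∏ t, (u t).elim x (fun _ => y) = (x + y) ^ Fintype.card T := by
    have : (Finset.univ.filter fun u : T → Option A => ∀ t, u t = none ∨ u t = some a) =
        Fintype.piFinset fun _ => {none, some a} := by
      ext u
      simp
    rw [this]
    refine (Finset.sum_prod_piFinset _ fun _ (o : Option A) => o.elim x fun _ => y).trans ?_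
    simp
  have sum_holes : ∑ u : T → Option A, (if u = fun _ => none then (Fintype.card A - 1 : R) else 0) *
      ∏ t, (u t).elim x (fun _ => y) = (Fintype.card A - 1) * x ^ Fintype.card T := by
    simp only [ite_mul, zero_mul]
    rw [Finset.sum_ite_eq' Finset.univ]
    simp
  rw [eq_sub_iff_add_eq, ← sum_holes, Finset.sum_filter]
  calc
    _ = ∑ u : T → Option A, (∑ a : A, if ∀ t, u t = none ∨ u t = some a then (1 : R) else 0) *
        ∏ t, (u t).elim x (fun _ => y) := by
      simp only [sum_forall_eq_none_or_eq_some, add_mul, Finset.sum_add_distrib, ite_mul, one_mul,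
        zero_mul]
    _ = ∑ a : A, ∑ u : T → Option A with ∀ t, u t = none ∨ u t = some a,
        ∏ t, (u t).elim x (fun _ => y) := by
      simp only [Finset.sum_mul, ite_mul, one_mul, zero_mul, Finset.sum_filter]
      exact Finset.sum_comm
    _ = _ := by simp [sum_words]

open Classical in
theorem sum_columnsCompatible_pow {C : Type*} [Fintype C] (κ : C → ℕ) (x y : R) :
    ∑ u : Cells κ → Option A with ColumnsCompatible u,
      x ^ numHoles u * y ^ (Fintype.card (Cells κ) - numHoles u) =
      ∏ c, (Fintype.card A * (x + y) ^ κ c - (Fintype.card A - 1) * x ^ κ c) := by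
  have weight (c) := sum_compatible_prod_elim (A := A) (T := Fin (κ c)) x y
  simp only [Fintype.card_fin] at weight
  simp only [← weight, ← prod_elim_eq_pow_numHoles, Finset.prod_univ_sum]
  refine Finset.sum_equiv (Equiv.piCurry fun (c : C) (_ : Fin (κ c)) => Option A)
    (fun u => ?_) fun u _ => Fintype.prod_sigma _
  simp only [Finset.mem_filter, Finset.mem_univ, true_and, Fintype.mem_piFinset]
  rfl

end ColumnWeight

section ColumnProb

/-- The probability that `k` independent random characters are pairwise compatible, if each of them
is a hole with probability `d` and otherwise one of `m` equally likely letters. -/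
noncomputable def columnProb (m : ℕ) (d : ℝ) (k : ℕ) : ℝ :=
  m * (d + (1 - d) / m) ^ k - (m - 1) * d ^ k

variable {m k : ℕ} {d : ℝ}

theorem columnProb_eq_Q_div (hm : m ≠ 0) (hk : 1 ≤ k) :
    columnProb m d k = Q m d k / (m : ℝ) ^ (k - 1) := by
  obtain ⟨k, rfl⟩ := Nat.exists_eq_add_of_le' hk
  have hQ : 1 + d * ((m : ℝ) - 1) = m * (d + (1 - d) / m) := by
    field_simp
    ring
  rw [columnProb, Q, hQ, Nat.add_sub_cancel, mul_pow, mul_pow, pow_succ (m : ℝ)]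
  field_simp

theorem columnProb_one (hm : m ≠ 0) : columnProb m d 1 = 1 := by
  rw [columnProb]
  field_simp
  ring

theorem columnProb_succ (hm : m ≠ 0) : columnProb m d (k + 1) =
    columnProb m d k - (m - 1) * (1 - d) * ((d + (1 - d) / m) ^ k - d ^ k) := by
  rw [columnProb, columnProb, pow_succ, pow_succ]
  field_simp
  ring

theorem columnProb_pos (hm : 1 ≤ m) (hd0 : 0 < d) (hd1 : d ≤ 1) : 0 < columnProb m d k := by
  have : (1 : ℝ) ≤ m := Nat.one_le_cast.2 hm
  have hpow : d ^ k ≤ (d + (1 - d) / m) ^ k := by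
    gcongr
    have := div_nonneg (sub_nonneg.2 hd1) m.cast_nonneg
    linarith
  have : 0 < d ^ k := by positivity
  rw [columnProb]
  nlinarith

theorem columnProb_lt_one (hm : 2 ≤ m) (hk : 2 ≤ k) (hd0 : 0 < d) (hd1 : d < 1) :
    columnProb m d k < 1 := by
  have hm0 : m ≠ 0 := by omega
  have hm1 : (1 : ℝ) < m := Nat.one_lt_cast.2 hm
  have hlt : d < d + (1 - d) / m := lt_add_of_pos_right d (div_pos (sub_pos.2 hd1) (by positivity))
  have succ_lt {j : ℕ} (hj : j ≠ 0) : columnProb m d (j + 1) < columnProb m d j := by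
    rw [columnProb_succ hm0]
    exact sub_lt_self _ (mul_pos (mul_pos (sub_pos.2 hm1) (sub_pos.2 hd1))
      (sub_pos.2 (pow_lt_pow_left₀ hlt hd0.le hj)))
  induction k, hk using Nat.le_induction with
  | base => exact (succ_lt one_ne_zero).trans_eq (columnProb_one hm0)
  | succ k hk ih => exact (succ_lt (by omega)).trans ih

end ColumnProb

section Arrangements

variable {W : Type*}

/-- A slack variable turns the inequality into an equation. -/
theorem ncard_setOf_sum_succ_le {ι : Type*} [Fintype ι] (N : ℕ) :
    {x : ι → ℕ | ∑ i, (x i + 1) ≤ N}.ncard = N.choose (Fintype.card ι) := by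
  classical
  have sum_succ (x : ι → ℕ) : ∑ i, (x i + 1) = ∑ i, x i + Fintype.card ι := by
    rw [Finset.sum_add_distrib, ← Finset.card_eq_sum_ones, Finset.card_univ]
  obtain hN | hN := lt_or_ge N (Fintype.card ι)
  · have hempty : {x : ι → ℕ | ∑ i, (x i + 1) ≤ N} = ∅ := by
      refine Set.eq_empty_of_forall_notMem fun x hx => ?_
      rw [Set.mem_ofPred_eq, sum_succ] at hx
      omega
    rw [hempty, Set.ncard_empty, Nat.choose_eq_zero_of_lt hN]
  obtain ⟨M, rfl⟩ := Nat.exists_eq_add_of_le hN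
  let solutions : Finset (Option ι →₀ ℕ) := Finset.univ.finsuppAntidiag M
  have mem_solutions {f} : f ∈ solutions ↔ f none + ∑ i, f (some i) = M := by
    rw [Finset.mem_finsuppAntidiag, and_iff_left (Finset.subset_univ _), ← Fintype.sum_option]
  have inj : Set.InjOn (fun (f : Option ι →₀ ℕ) i => f (some i)) solutions := by
    intro f hf g hg hfg
    have hsome (i) : f (some i) = g (some i) := congrFun hfg i
    simp only [Finset.mem_coe, mem_solutions, hsome] at hf hg
    ext (_ | i)
    · omega
    · exact hsome i
  have himage : {x : ι → ℕ | ∑ i, (x i + 1) ≤ Fintype.card ι + M} =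
      (fun f i => f (some i)) '' (solutions : Set (Option ι →₀ ℕ)) := by
    ext x
    simp only [Set.mem_ofPred_eq, sum_succ, Set.mem_image, Finset.mem_coe, mem_solutions]
    refine ⟨fun hx => ?_, ?_⟩
    · refine ⟨Finsupp.equivFunOnFinite.symm fun o => o.elim (M - ∑ i, x i) x, ?_, rfl⟩
      simp only [Finsupp.equivFunOnFinite_symm_apply_apply, Option.elim]
      omega
    · rintro ⟨f, rfl, rfl⟩
      dsimp only
      omega
  rw [himage, inj.ncard_image, Set.ncard_coe_finset, Finset.card_finsuppAntidiag_nat_eq_choose,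
    Finset.card_univ, Fintype.card_option]
  rw [show Fintype.card ι + 1 + M - 1 = Fintype.card ι + M by omega, Nat.choose_symm_add]

/-- The variables with multiplicity at least two. -/
abbrev Repeated (k : W → ℕ) : Type _ := {v // 2 ≤ k v}

/-- The variables with multiplicity at most one. -/
abbrev Unrepeated (k : W → ℕ) : Type _ := {v // ¬ 2 ≤ k v}

variable [Fintype W] {k : W → ℕ} {n : ℕ}

/-- The pairs `(i, l)` such that a factor of length `∑ v, k v * (l v + 1)`, the length of the image
of a pattern if the variable `v` has multiplicity `k v` and an image of length `l v + 1`, may start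
at the position `i` of a word of length `n`. -/
def arrangements [DecidableEq W] (k : W → ℕ) (n : ℕ) : Finset (ℕ × (W → ℕ)) :=
  (Finset.range (n + 1) ×ˢ Fintype.piFinset fun _ => Finset.range n).filter
    fun z => z.1 + ∑ v, k v * (z.2 v + 1) ≤ n

theorem mem_arrangements [DecidableEq W] (hk : ∀ v, 0 < k v) {z : ℕ × (W → ℕ)} :
    z ∈ arrangements k n ↔ z.1 + ∑ v, k v * (z.2 v + 1) ≤ n := by
  simp only [arrangements, Finset.mem_filter, Finset.mem_product, Finset.mem_range,
    Fintype.mem_piFinset]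
  refine and_iff_right_of_imp fun hz => ⟨by omega, fun v => ?_⟩
  have h₁ := Nat.le_mul_of_pos_left (z.2 v + 1) (hk v)
  have h₂ := Finset.single_le_sum_of_canonicallyOrdered (f := fun v => k v * (z.2 v + 1))
    (Finset.mem_univ v)
  omega

theorem sum_mul_succ_eq (hk : ∀ v, 0 < k v) (l : W → ℕ) : ∑ v, k v * (l v + 1) =
    ∑ v : Repeated k, k v * (l v + 1) + ∑ v : Unrepeated k, (l v + 1) := by
  rw [← Fintype.sum_subtype_add_sum_subtype (fun v => 2 ≤ k v)]
  congr 1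
  refine Finset.sum_congr rfl fun v _ => ?_
  have := hk v
  have := v.2
  rw [show k v = 1 by omega, one_mul]

/-- The slack before the factor plays the part of a further unrepeated variable, which may have an
empty image. -/
theorem card_filter_arrangements [DecidableEq W] (hk : ∀ v, 0 < k v) (l : Repeated k → ℕ) :
    ((arrangements k n).filter fun z => (fun v : Repeated k => z.2 v) = l).card =
      (n + 1 - ∑ v : Repeated k, k v * (l v + 1)).choose (Fintype.card (Unrepeated k) + 1) := by
  let e := Equiv.piEquivPiSubtypeProd (fun v => 2 ≤ k v) fun _ => ℕ
  let extend (x : Option (Unrepeated k) → ℕ) : ℕ × (W → ℕ) :=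
    (x none, e.symm (l, fun v => x (some v)))
  have extend_injective : extend.Injective := by
    intro x y hxy
    obtain ⟨hnone, hsome⟩ := Prod.mk.inj hxy
    ext (_ | v)
    · exact hnone
    · exact congrFun (Prod.mk.inj (e.symm.injective hsome)).2 v
  rw [← Fintype.card_option, ← ncard_setOf_sum_succ_le,
    ← Set.ncard_image_of_injective _ extend_injective, ← Set.ncard_coe_finset]
  congr 1
  ext ⟨i, l'⟩
  obtain ⟨⟨lr, lu⟩, rfl⟩ := e.symm.surjective l'
  have hr (v : Repeated k) : e.symm (lr, lu) v = lr v :=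
    congrFun (congrArg Prod.fst (e.apply_symm_apply (lr, lu))) v
  have hu (v : Unrepeated k) : e.symm (lr, lu) v = lu v :=
    congrFun (congrArg Prod.snd (e.apply_symm_apply (lr, lu))) v
  simp only [Finset.coe_filter, mem_arrangements hk, sum_mul_succ_eq hk, Set.mem_ofPred_eq,
    Set.mem_image, hr, hu]
  constructor
  · rintro ⟨hle, rfl⟩
    refine ⟨fun o => o.elim i lu, ?_, rfl⟩
    rw [Fintype.sum_option]
    simp only [Option.elim]
    omega
  · rintro ⟨x, hle, hx⟩
    obtain ⟨rfl, hlx⟩ := Prod.mk.inj hx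
    obtain ⟨rfl, rfl⟩ := Prod.mk.inj (e.symm.injective hlx)
    rw [Fintype.sum_option] at hle
    refine ⟨?_, rfl⟩
    dsimp only
    omega

theorem sum_comp_eq_tsum {α β : Type*} [DecidableEq β] (s : Finset α) (π : α → β) (g : β → ℝ) :
    ∑ a ∈ s, g (π a) = ∑' b, g b * (s.filter fun a => π a = b).card := by
  rw [tsum_eq_sum (s := s.image π), Finset.sum_comp]
  · simp only [nsmul_eq_mul, mul_comm]
  · intro b hb
    rw [Finset.filter_false_of_mem, Finset.card_empty, Nat.cast_zero, mul_zero]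
    exact fun a ha hab => hb (hab ▸ Finset.mem_image_of_mem π ha)

theorem sum_arrangements_eq_tsum [DecidableEq W] (hk : ∀ v, 0 < k v) (g : (Repeated k → ℕ) → ℝ) :
    ∑ z ∈ arrangements k n, g (fun v => z.2 v) = ∑' l : Repeated k → ℕ, g l *
      (n + 1 - ∑ v : Repeated k, k v * (l v + 1)).choose (Fintype.card (Unrepeated k) + 1) := by
  simp only [← card_filter_arrangements hk]
  exact sum_comp_eq_tsum _ (fun (z : ℕ × (W → ℕ)) (v : Repeated k) => z.2 v) g

end Arrangements

section MeanOccurrences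

/-- The sizes of the columns of the labels `(v, c)` with `c < l v`, if `v` has multiplicity
`k v`. -/
abbrev columnSizes {R : Type*} (k l : R → ℕ) : (Σ v, Fin (l v)) → ℕ :=
  fun c => k c.1

theorem card_cells_columnSizes {R : Type*} [Fintype R] (k l : R → ℕ) :
    Fintype.card (Cells (columnSizes k l)) = ∑ v, k v * l v := by
  simp [columnSizes, Fintype.sum_sigma, mul_comm]

theorem prod_columnSizes {R M : Type*} [Fintype R] [CommMonoid M] (f : ℕ → M) (k l : R → ℕ) :
    ∏ c, f (columnSizes k l c) = ∏ v, f (k v) ^ l v := by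
  rw [Fintype.prod_sigma]
  simp only [columnSizes, Finset.prod_const, Finset.card_univ, Fintype.card_fin]

theorem exists_columnsCompatible_comp_iff {A W : Type*} [DecidableEq W] {q : List W}
    {k l : W → ℕ} (hk : ∀ v, q.count v = k v) {n i : ℕ} (hi : i + (labels q l).length ≤ n) :
    ∃ e : Cells (columnSizes (fun v : Repeated k => k v) fun v => l v) ↪ Fin n,
      ∀ w : Fin n → Option A,
        LabelCompatible ((List.ofFn w).drop i) (labels q l) ↔ ColumnsCompatible (w ∘ e) := by
  let L := labels q l
  have card_fiber {x : W × ℕ} (hx : x.2 < l x.1) :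
      (Finset.univ.filter fun j => L.get j = x).card = k x.1 := by
    rw [← hk, ← count_labels q hx]
    convert Fin.card_filter_univ_eq_vector_get_eq_count x ⟨L, rfl⟩ <;> rfl
  let γ (c : Σ v : Repeated k, Fin (l v)) : W × ℕ := (c.1, c.2)
  have γ_injective : γ.Injective := by
    rintro ⟨⟨v, _⟩, c⟩ ⟨⟨v', _⟩, c'⟩ h
    obtain ⟨rfl, hc⟩ : v = v' ∧ (c : ℕ) = c' := Prod.mk.inj h
    obtain rfl := Fin.ext hc
    rfl
  have hunique (j j') (hj : L.get j = L.get j') : j = j' ∨ L.get j ∈ Set.range γ := by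
    have hlt := (mem_labels.1 (L.get_mem j)).2
    by_cases hv : 2 ≤ k (L.get j).1
    · exact .inr ⟨⟨⟨_, hv⟩, ⟨_, hlt⟩⟩, rfl⟩
    · have : (Finset.univ.filter fun j' => L.get j' = L.get j).card ≤ 1 := by
        rw [card_fiber hlt]
        omega
      refine .inl (Finset.card_le_one.1 this _ ?_ _ ?_) <;> simp only [Finset.mem_filter_univ, hj]
  obtain ⟨e, he⟩ := exists_cells_embedding (A := A) γ_injective (fun c => card_fiber c.2.2) hunique
  exact ⟨e.trans ((Fin.natAddEmb i).trans (Fin.castLEEmb hi)), fun w =>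
    (labelCompatible_drop_ofFn_iff hi).trans (he _)⟩

theorem withDensity_eq {A : Type*} [Fintype A] {n K : ℕ} {d : ℚ} (hn : 0 < n)
    (hK : (K : ℚ) = d * n) : withDensity A n d = withNumHoles (Fin n) A K := by
  have hn' : (n : ℚ) ≠ 0 := by positivity
  ext w
  simp only [withDensity, withNumHoles, Finset.mem_filter, Finset.mem_univ, true_and,
    div_eq_iff hn', ← hK, Nat.cast_inj]
  rfl

variable {V A : Type*} [DecidableEq V] (p : List V) {n : ℕ}

/-- The multiplicities of the variables of the pattern `p`. -/
abbrev multiplicity (v : {v // v ∈ p}) : ℕ :=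
  p.count v.1

/-- The Boolean equality on `{v // v ∈ p}` is the one derived from `DecidableEq`, not
`Subtype.instBEq` as in `List.count_attach`. -/
theorem count_attach (v : {v // v ∈ p}) :
    @List.count _ instBEqOfDecidableEq v p.attach = multiplicity p v := by
  rw [multiplicity, ← List.count_attach]
  congr 1
  exact lawful_beq_subsingleton _ _

open Classical in
theorem ncard_occurrences_ofFn (w : Fin n → Option A) :
    (occurrences p (List.ofFn w)).ncard = ((arrangements (multiplicity p) n).filter fun z =>
      LabelCompatible ((List.ofFn w).drop z.1) (labels p.attach fun v => z.2 v + 1)).card := by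
  have hk (v : {v // v ∈ p}) : 0 < multiplicity p v := List.count_pos_iff.2 v.2
  rw [ncard_occurrences, ← Set.ncard_coe_finset]
  simp only [Finset.coe_filter, mem_arrangements hk, length_labels, count_attach, List.length_ofFn]

variable [Fintype A] [Nonempty A]

open Classical in
theorem card_filter_labelCompatible {K i : ℕ} (hK : K ≤ n) {l : {v // v ∈ p} → ℕ}
    (hi : i + ∑ v, multiplicity p v * l v ≤ n) :
    (((withNumHoles (Fin n) A K).filter fun w =>
      LabelCompatible ((List.ofFn w).drop i) (labels p.attach l)).card : ℝ) =
      (withNumHoles (Fin n) A K).card * compatProb A n K (columnSizes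
        (fun v : Repeated (multiplicity p) => multiplicity p v) fun v => l v) := by
  have hi' : i + (labels p.attach l).length ≤ n := by
    simpa only [length_labels, count_attach] using hi
  obtain ⟨e, he⟩ := exists_columnsCompatible_comp_iff (A := A) (count_attach p) hi'
  simp only [he]
  exact card_filter_columnsCompatible hK e.injective

/-- The sum runs over the lengths of the images of the repeated variables, decreased by one. -/
theorem meanOccurrences_eq_tsum {K : ℕ} {d : ℚ} (hn : 0 < n) (hK : (K : ℚ) = d * n) (hKn : K ≤ n) :
    meanOccurrences p A n d = ∑' l : Repeated (multiplicity p) → ℕ,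
      compatProb A n K (columnSizes (fun v : Repeated (multiplicity p) => multiplicity p v)
        fun v => l v + 1) *
        (n + 1 - ∑ v : Repeated (multiplicity p), multiplicity p v * (l v + 1)).choose
          (Fintype.card (Unrepeated (multiplicity p)) + 1) := by
  classical
  have hk (v : {v // v ∈ p}) : 0 < multiplicity p v := List.count_pos_iff.2 v.2
  have hpos : (0 : ℝ) < (withNumHoles (Fin n) A K).card :=
    Nat.cast_pos.2 (card_withNumHoles_fin_pos hKn)
  let prob (l : Repeated (multiplicity p) → ℕ) : ℝ := compatProb A n K
    (columnSizes (fun v : Repeated (multiplicity p) => multiplicity p v) fun v => l v + 1)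
  rw [meanOccurrences, withDensity_eq hn hK, div_eq_iff hpos.ne']
  calc
    _ = ∑ z ∈ arrangements (multiplicity p) n,
        (((withNumHoles (Fin n) A K).filter fun w => LabelCompatible ((List.ofFn w).drop z.1)
          (labels p.attach fun v => z.2 v + 1)).card : ℝ) := by
      simp only [ncard_occurrences_ofFn]
      exact_mod_cast Finset.sum_card_bipartiteAbove_eq_sum_card_bipartiteBelow _
    _ = (∑ z ∈ arrangements (multiplicity p) n, prob fun v => z.2 v) *
        (withNumHoles (Fin n) A K).card := by
      rw [Finset.sum_mul]
      refine Finset.sum_congr rfl fun z hz => ?_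
      rw [card_filter_labelCompatible p hKn ((mem_arrangements hk).1 hz), mul_comm]
    _ = _ := by
      rw [sum_arrangements_eq_tsum hk]

end MeanOccurrences

section Series

theorem hasSum_mul_of_nonneg {β γ : Type*} {f : β → ℝ} {g : γ → ℝ} {a b : ℝ} (hf0 : 0 ≤ f)
    (hg0 : 0 ≤ g) (hf : HasSum f a) (hg : HasSum g b) :
    HasSum (fun x : β × γ => f x.1 * g x.2) (a * b) :=
  hf.mul hg (hf.summable.mul_of_nonneg hg.summable hf0 hg0)

theorem hasSum_prod_apply_fin {β : Type*} {k : ℕ} {f : Fin k → β → ℝ} {a : Fin k → ℝ}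
    (hf0 : ∀ i x, 0 ≤ f i x) (hf : ∀ i, HasSum (f i) (a i)) :
    HasSum (fun x : Fin k → β => ∏ i, f i (x i)) (∏ i, a i) := by
  induction k with
  | zero => simp
  | succ k ih =>
    have tail := ih (fun i => hf0 i.succ) fun i => hf i.succ
    have head_mul_tail := hasSum_mul_of_nonneg (f := f 0)
      (g := fun x : Fin k → β => ∏ i : Fin k, f i.succ (x i)) (hf0 0)
      (fun x => Finset.prod_nonneg fun i _ => hf0 i.succ (x i)) (hf 0) tail
    rw [← (Fin.consEquiv fun _ : Fin (k + 1) => β).hasSum_iff, Fin.prod_univ_succ]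
    convert head_mul_tail using 2 with x
    simp [Fin.prod_univ_succ, Fin.consEquiv]

theorem hasSum_prod_apply {ι β : Type*} [Fintype ι] {f : ι → β → ℝ} {a : ι → ℝ}
    (hf0 : ∀ i x, 0 ≤ f i x) (hf : ∀ i, HasSum (f i) (a i)) :
    HasSum (fun x : ι → β => ∏ i, f i (x i)) (∏ i, a i) := by
  let e := (Fintype.equivFin ι).symm
  have := hasSum_prod_apply_fin (fun i => hf0 (e i)) fun i => hf (e i)
  rw [e.prod_comp a] at this
  rw [← (e.arrowCongr (Equiv.refl β)).hasSum_iff]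
  convert this using 2 with x
  rw [Function.comp_apply, ← e.prod_comp]
  simp

theorem summable_pow_div {r : ℝ} (hr0 : 0 ≤ r) (hr1 : r < 1) {N : ℕ} (hN : N ≠ 0) :
    Summable fun j : ℕ => r ^ (j / N) := by
  have : NeZero N := ⟨hN⟩
  have summable_prod : Summable fun x : ℕ × Fin N => r ^ x.1 * (1 : ℝ) :=
    (summable_geometric_of_lt_one hr0 hr1).mul_of_nonneg
      (.of_finite (f := fun _ : Fin N => (1 : ℝ))) (fun _ => pow_nonneg hr0 _) fun _ => zero_le_one
  rw [← (Nat.divModEquiv N).summable_iff] at summable_prod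
  exact summable_prod.congr fun j => mul_one _

variable {R : Type*} [Fintype R] {q : R → ℝ}

theorem hasSum_prod_pow_succ (hq0 : ∀ v, 0 ≤ q v) (hq1 : ∀ v, q v < 1) :
    HasSum (fun l : R → ℕ => ∏ v, q v ^ (l v + 1)) (∏ v, q v / (1 - q v)) := by
  refine hasSum_prod_apply (f := fun v j => q v ^ (j + 1))
    (fun v j => pow_nonneg (hq0 v) (j + 1)) fun v => ?_
  simp only [pow_succ', div_eq_mul_inv]
  exact (hasSum_geometric_of_lt_one (hq0 v) (hq1 v)).mul_left (q v)

theorem summable_prod_pow_succ_div (hq0 : ∀ v, 0 ≤ q v) (hq1 : ∀ v, q v < 1) {N : ℕ}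
    (hN : N ≠ 0) : Summable fun l : R → ℕ => ∏ v, q v ^ ((l v + 1) / N) :=
  (hasSum_prod_apply (f := fun v j => q v ^ ((j + 1) / N))
    (fun v j => pow_nonneg (hq0 v) ((j + 1) / N)) fun v =>
      ((summable_nat_add_iff 1).2 (summable_pow_div (hq0 v) (hq1 v) hN)).hasSum).summable

theorem exists_mul_pow_lt_one {R : Type*} [Finite R] {q : R → ℝ} (k : R → ℕ) (hq : ∀ v, q v < 1) :
    ∃ N : ℕ, 2 ≤ N ∧ ∀ v, q v * ((N : ℝ) / (N - 1)) ^ k v < 1 := by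
  have tendsto_div : Tendsto (fun N : ℕ => (N : ℝ) / (N - 1)) atTop (nhds 1) := by
    simpa only [sub_eq_add_neg] using tendsto_natCast_div_add_atTop (𝕜 := ℝ) (-1)
  have eventually_lt (v) : ∀ᶠ N : ℕ in atTop, q v * ((N : ℝ) / (N - 1)) ^ k v < 1 := by
    have := (tendsto_div.pow (k v)).const_mul (q v)
    rw [one_pow, mul_one] at this
    exact this.eventually_lt_const (hq v)
  exact ((eventually_ge_atTop 2).and (eventually_all.2 eventually_lt)).exists

end Series

section Domination

theorem natCast_le_of_eq_mul {K n : ℕ} {d : ℝ} (hK : (K : ℝ) = d * n) (hd1 : d ≤ 1) : K ≤ n := by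
  have : (K : ℝ) ≤ n := hK.trans_le (mul_le_of_le_one_left n.cast_nonneg hd1)
  exact_mod_cast this

theorem natCast_sub_of_eq_mul {K n : ℕ} {d : ℝ} (hK : (K : ℝ) = d * n) (hd1 : d ≤ 1) :
    ((n - K : ℕ) : ℝ) = (1 - d) * n := by
  rw [Nat.cast_sub (natCast_le_of_eq_mul hK hd1), hK]
  ring

theorem patternProb_le {m n K h g N : ℕ} {d : ℝ} (hm : 0 < m) (hn : 0 < n) (hN : 2 ≤ N)
    (hK : (K : ℝ) = d * n) (hd0 : 0 ≤ d) (hd1 : d ≤ 1) (hL : (h + g) * N ≤ n) :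
    patternProb m n K h g ≤ d ^ h * ((1 - d) / m) ^ g * ((N : ℝ) / (N - 1)) ^ (h + g) := by
  have : (0 : ℝ) < n := Nat.cast_pos.2 hn
  have hN' : (2 : ℝ) ≤ N := Nat.ofNat_le_cast.2 hN
  have hB : (0 : ℝ) < N / (N - 1) := div_pos (by linarith) (by linarith)
  have hLn : h + g ≤ n := (Nat.le_mul_of_pos_right _ (by omega)).trans hL
  have hL' : ((h + g : ℕ) : ℝ) * N ≤ n := by exact_mod_cast hL
  have num_holes : (K.descFactorial h : ℝ) ≤ (d * n) ^ h := by
    rw [← hK]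
    exact_mod_cast Nat.descFactorial_le_pow K h
  have num_letters : ((n - K).descFactorial g : ℝ) ≤ ((1 - d) * n) ^ g := by
    rw [← natCast_sub_of_eq_mul hK hd1]
    exact_mod_cast Nat.descFactorial_le_pow (n - K) g
  have denom : (n / ((N : ℝ) / (N - 1))) ^ (h + g) ≤ n.descFactorial (h + g) := by
    calc (n / ((N : ℝ) / (N - 1))) ^ (h + g) ≤ ((n + 1 - (h + g) : ℕ) : ℝ) ^ (h + g) := by
          refine pow_le_pow_left₀ (by positivity) ?_ _
          rw [Nat.cast_sub (by omega), Nat.cast_add, Nat.cast_one, div_div_eq_mul_div,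
            div_le_iff₀ (by linarith)]
          nlinarith
      _ ≤ _ := by exact_mod_cast Nat.pow_sub_le_descFactorial n (h + g)
  have : 0 ≤ 1 - d := sub_nonneg.2 hd1
  rw [patternProb]
  calc _ ≤ (d * n) ^ h * ((1 - d) * n) ^ g /
        ((n / ((N : ℝ) / (N - 1))) ^ (h + g) * (m : ℝ) ^ g) := by gcongr
    _ = _ := by
      rw [div_pow (n : ℝ), div_pow (1 - d), mul_pow, mul_pow, pow_add (n : ℝ)]
      field_simp

variable {A : Type*} [Fintype A] [Nonempty A] {n K N : ℕ} {d : ℝ}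

open Classical in
theorem compatProb_le_prod {C : Type*} [Fintype C] {κ : C → ℕ} (hn : 0 < n) (hN : 2 ≤ N)
    (hK : (K : ℝ) = d * n) (hd0 : 0 ≤ d) (hd1 : d ≤ 1) (hκ : Fintype.card (Cells κ) * N ≤ n) :
    compatProb A n K κ ≤
      ∏ c, columnProb (Fintype.card A) d (κ c) * ((N : ℝ) / (N - 1)) ^ κ c := by
  have prod_eq : ∏ c, columnProb (Fintype.card A) d (κ c) * ((N : ℝ) / (N - 1)) ^ κ c =
      (∑ u : Cells κ → Option A with ColumnsCompatible u, d ^ numHoles u *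
        ((1 - d) / Fintype.card A) ^ (Fintype.card (Cells κ) - numHoles u)) *
        ((N : ℝ) / (N - 1)) ^ Fintype.card (Cells κ) := by
    have card_cells : Fintype.card (Cells κ) = ∑ c, κ c := by simp
    rw [sum_columnsCompatible_pow, card_cells, ← Finset.prod_pow_eq_pow_sum,
      ← Finset.prod_mul_distrib]
    rfl
  rw [prod_eq, compatProb, Finset.sum_mul]
  refine Finset.sum_le_sum fun u _ => ?_
  have hu : numHoles u + (Fintype.card (Cells κ) - numHoles u) = Fintype.card (Cells κ) :=
    Nat.add_sub_cancel' (numHoles_le_card u)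
  rw [← hu] at hκ
  simpa only [hu] using patternProb_le (Fintype.card_pos (α := A)) hn hN hK hd0 hd1 hκ

/-- By monotonicity, it is enough to bound the probability for `l v / N` of the `l v` columns of
each size `k v`; their cells fill at most `1 / N` of the word. -/
theorem compatProb_columnSizes_le_prod {R : Type*} [Fintype R] {k l : R → ℕ}
    (hn : 0 < n) (hN : 2 ≤ N) (hK : (K : ℝ) = d * n) (hd0 : 0 ≤ d) (hd1 : d ≤ 1)
    (hl : ∑ v, k v * l v ≤ n) :
    compatProb A n K (columnSizes k l) ≤
      ∏ v, (columnProb (Fintype.card A) d (k v) * ((N : ℝ) / (N - 1)) ^ k v) ^ (l v / N) := by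
  let thin : (Σ v, Fin (l v / N)) → Σ v, Fin (l v) :=
    Sigma.map id fun v => Fin.castLE (Nat.div_le_self (l v) N)
  have thin_injective : thin.Injective :=
    Function.injective_id.sigma_map fun v => Fin.castLE_injective _
  have card_thin : Fintype.card (Cells (columnSizes k fun v => l v / N)) * N ≤ n := by
    rw [card_cells_columnSizes, Finset.sum_mul]
    refine (Finset.sum_le_sum fun v _ => ?_).trans hl
    rw [mul_assoc]
    exact Nat.mul_le_mul_left _ (Nat.div_mul_le_self _ _)
  have thinned := compatProb_le_comp (A := A) (natCast_le_of_eq_mul hK hd1)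
    ((card_cells_columnSizes k l).trans_le hl) thin_injective
  have bound := compatProb_le_prod (A := A) hn hN hK hd0 hd1 card_thin
  exact thinned.trans (bound.trans_eq
    (prod_columnSizes (fun j => columnProb (Fintype.card A) d j * ((N : ℝ) / (N - 1)) ^ j) _ _))

end Domination

section Limits

variable {F : Filter ℕ} {K : ℕ → ℕ} {d : ℝ}

theorem tendsto_descFactorial_div {x : ℕ → ℕ} (hx : Tendsto x F atTop) (h : ℕ) :
    Tendsto (fun n => ((x n).descFactorial h : ℝ) / (x n : ℝ) ^ h) F (nhds 1) := by
  have := isEquivalent_descFactorial h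
  rw [isEquivalent_iff_tendsto_one] at this
  · exact this.comp hx
  · filter_upwards [eventually_gt_atTop 0] with n hn
    positivity

theorem tendsto_atTop_of_eq_mul {x : ℕ → ℕ} {c : ℝ} (hF : F ≤ atTop) (hc : 0 < c)
    (hx : ∀ᶠ n in F, (x n : ℝ) = c * n) : Tendsto x F atTop := by
  have natCast_atTop : Tendsto (fun n : ℕ => (n : ℝ)) F atTop :=
    tendsto_natCast_atTop_atTop.mono_left hF
  rw [← tendsto_natCast_atTop_iff (R := ℝ)]
  exact (natCast_atTop.const_mul_atTop hc).congr' (hx.mono fun n hn => hn.symm)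

theorem tendsto_patternProb {m : ℕ} (hm : 0 < m) (hF : F ≤ atTop)
    (hK : ∀ᶠ n in F, (K n : ℝ) = d * n) (hd0 : 0 < d) (hd1 : d < 1) (h g : ℕ) :
    Tendsto (fun n => patternProb m n (K n) h g) F (nhds (d ^ h * ((1 - d) / m) ^ g)) := by
  have : (0 : ℝ) < m := Nat.cast_pos.2 hm
  have hd1' : 0 < 1 - d := sub_pos.2 hd1
  have hK' : ∀ᶠ n in F, ((n - K n : ℕ) : ℝ) = (1 - d) * n :=
    hK.mono fun n hn => natCast_sub_of_eq_mul hn hd1.le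
  have lim := (((tendsto_descFactorial_div (tendsto_atTop_of_eq_mul hF hd0 hK) h).mul
    (tendsto_descFactorial_div (tendsto_atTop_of_eq_mul hF hd1' hK') g)).div
    (tendsto_descFactorial_div hF (h + g)) one_ne_zero).mul_const (d ^ h * ((1 - d) / m) ^ g)
  rw [mul_one, div_one, one_mul] at lim
  refine lim.congr' ?_
  filter_upwards [hK, hK', hF (eventually_gt_atTop 0)] with n hn hn' hn_pos
  have : (0 : ℝ) < n := Nat.cast_pos.2 hn_pos
  simp only [Pi.div_apply]
  rw [hn, hn', patternProb, div_pow, mul_pow, mul_pow, pow_add]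
  field_simp

theorem tendsto_compatProb {A C : Type*} [Fintype A] [Nonempty A] [Fintype C] (κ : C → ℕ)
    (hF : F ≤ atTop) (hK : ∀ᶠ n in F, (K n : ℝ) = d * n) (hd0 : 0 < d) (hd1 : d < 1) :
    Tendsto (fun n => compatProb A n (K n) κ) F
      (nhds (∏ c, columnProb (Fintype.card A) d (κ c))) := by
  classical
  have := sum_columnsCompatible_pow (A := A) κ d ((1 - d) / Fintype.card A)
  simp only [columnProb, ← this]
  exact tendsto_finsetSum _ fun u _ => tendsto_patternProb Fintype.card_pos hF hK hd0 hd1 _ _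

theorem tendsto_choose_div_pow (hF : F ≤ atTop) (x s : ℕ) :
    Tendsto (fun n : ℕ => ((n + 1 - x).choose s : ℝ) / (n : ℝ) ^ s) F (nhds (1 / (s ! : ℝ))) := by
  have choose_equiv := isEquivalent_choose s
  rw [isEquivalent_iff_tendsto_one] at choose_equiv
  swap
  · filter_upwards [eventually_gt_atTop 0] with n hn
    positivity
  have shift_atTop : Tendsto (fun n : ℕ => n + 1 - x) F atTop :=
    ((tendsto_sub_atTop_nat x).comp (tendsto_add_atTop_nat 1)).mono_left hF
  have ratio : Tendsto (fun n : ℕ => 1 + (1 - (x : ℝ)) / n) F (nhds (1 + 0)) :=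
    tendsto_const_nhds.add ((tendsto_const_div_atTop_nhds_zero_nat _).mono_left hF)
  have lim := ((choose_equiv.comp shift_atTop).mul (ratio.pow s)).mul_const (1 / (s ! : ℝ))
  rw [add_zero, one_pow, mul_one, one_mul] at lim
  refine lim.congr' ?_
  filter_upwards [hF (eventually_gt_atTop 0), hF (eventually_ge_atTop x)] with n hn hx
  have : (0 : ℝ) < n := Nat.cast_pos.2 hn
  have ratio_eq : 1 + (1 - (x : ℝ)) / n = (n + 1 - x : ℕ) / n := by
    rw [Nat.cast_sub (by omega)]
    field_simp
    push_cast
    ring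
  have shift_pos : (0 : ℝ) < (n + 1 - x : ℕ) := Nat.cast_pos.2 (by omega)
  simp only [Function.comp_apply, Pi.div_apply]
  rw [ratio_eq, div_pow]
  field_simp

theorem choose_div_pow_le {n : ℕ} (hn : 0 < n) (x s : ℕ) :
    ((n + 1 - x).choose s : ℝ) / (n : ℝ) ^ s ≤ 2 ^ s := by
  have : (0 : ℝ) < n := Nat.cast_pos.2 hn
  rw [div_le_iff₀ (by positivity), ← mul_pow]
  calc ((n + 1 - x).choose s : ℝ) ≤ ((n + 1 - x : ℕ) : ℝ) ^ s := by
        exact_mod_cast Nat.choose_le_pow _ _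
    _ ≤ _ := by
        refine pow_le_pow_left₀ (by positivity) ?_ s
        exact_mod_cast (by omega : n + 1 - x ≤ 2 * n)

end Limits

section MainTerm

variable {A R : Type*} [Fintype A] [Nonempty A] [Fintype R] {k l : R → ℕ} {d : ℝ}

theorem compatProb_mul_choose_le {n K N : ℕ} (hn : 0 < n) (hN : 2 ≤ N)
    (hK : (K : ℝ) = d * n) (hd0 : 0 < d) (hd1 : d ≤ 1) (s : ℕ) :
    compatProb A n K (columnSizes k l) *
        ((n + 1 - ∑ v, k v * l v).choose (s + 1) / (n : ℝ) ^ (s + 1)) ≤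
      (∏ v, (columnProb (Fintype.card A) d (k v) * ((N : ℝ) / (N - 1)) ^ k v) ^ (l v / N)) *
        2 ^ (s + 1) := by
  have hN' : (2 : ℝ) ≤ N := Nat.ofNat_le_cast.2 hN
  have prod_nonneg : 0 ≤
      ∏ v, (columnProb (Fintype.card A) d (k v) * ((N : ℝ) / (N - 1)) ^ k v) ^ (l v / N) :=
    Finset.prod_nonneg fun v _ => pow_nonneg (mul_nonneg
      (columnProb_pos Fintype.card_pos hd0 hd1).le
      (pow_nonneg (div_nonneg (by linarith) (by linarith)) _)) _
  by_cases hl : ∑ v, k v * l v ≤ n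
  · exact mul_le_mul (compatProb_columnSizes_le_prod hn hN hK hd0.le hd1 hl)
      (choose_div_pow_le hn _ _) (by positivity) prod_nonneg
  · rw [Nat.sub_eq_zero_of_le (by omega), Nat.choose_zero_succ]
    simp only [Nat.cast_zero, zero_div, mul_zero]
    positivity

theorem tendsto_tsum_compatProb {F : Filter ℕ} {K : ℕ → ℕ} (hF : F ≤ atTop)
    (hK : ∀ᶠ n in F, (K n : ℝ) = d * n) (hd0 : 0 < d) (hd1 : d < 1)
    (hq : ∀ v, columnProb (Fintype.card A) d (k v) < 1) (s : ℕ) :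
    Tendsto (fun n => ∑' l : R → ℕ, compatProb A n (K n) (columnSizes k fun v => l v + 1) *
        ((n + 1 - ∑ v, k v * (l v + 1)).choose (s + 1) / (n : ℝ) ^ (s + 1))) F
      (nhds ((∏ v, columnProb (Fintype.card A) d (k v) /
        (1 - columnProb (Fintype.card A) d (k v))) * (1 / ((s + 1)! : ℝ)))) := by
  have columnProb_nonneg (v) : 0 ≤ columnProb (Fintype.card A) d (k v) :=
    (columnProb_pos Fintype.card_pos hd0 hd1.le).le
  obtain ⟨N, hN, hρ⟩ := exists_mul_pow_lt_one k hq
  have hN' : (2 : ℝ) ≤ N := Nat.ofNat_le_cast.2 hN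
  have ρ_nonneg (v) : 0 ≤ columnProb (Fintype.card A) d (k v) * ((N : ℝ) / (N - 1)) ^ k v :=
    mul_nonneg (columnProb_nonneg v) (pow_nonneg (div_nonneg (by linarith) (by linarith)) _)
  rw [← ((hasSum_prod_pow_succ columnProb_nonneg hq).mul_right (1 / ((s + 1)! : ℝ))).tsum_eq]
  refine tendsto_tsum_of_dominated_convergence
    ((summable_prod_pow_succ_div ρ_nonneg hρ (by omega : N ≠ 0)).mul_right (2 ^ (s + 1)))
    (fun l => ?_) ?_
  · rw [← prod_columnSizes (columnProb (Fintype.card A) d)]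
    exact (tendsto_compatProb _ hF hK hd0 hd1).mul (tendsto_choose_div_pow hF _ _)
  · filter_upwards [hK, hF (eventually_gt_atTop 0)] with n hKn hn l
    rw [Real.norm_of_nonneg (mul_nonneg (compatProb_nonneg _ _) (by positivity))]
    exact compatProb_mul_choose_le hn hN hKn hd0 hd1.le s

end MainTerm

theorem isEquivalent_mul_const_of_tendsto_div {α : Type*} {F : Filter α} {u v : α → ℝ} {c : ℝ}
    (hc : c ≠ 0) (hv : ∀ᶠ x in F, v x ≠ 0) (h : Tendsto (fun x => u x / v x) F (nhds c)) :
    u ~[F] fun x => v x * c := by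
  rw [← isEquivalent_const_iff_tendsto hc] at h
  refine (IsEquivalent.refl.mul h).congr_left (hv.mono fun x hx => ?_)
  exact mul_div_cancel₀ _ hx

section MeanOccurrencesLimit

theorem columnProb_div_one_sub {m k : ℕ} {d : ℝ} (hm : m ≠ 0) (hk : 1 ≤ k) :
    columnProb m d k / (1 - columnProb m d k) = Q m d k / ((m : ℝ) ^ (k - 1) - Q m d k) := by
  have hpow : (m : ℝ) ^ (k - 1) ≠ 0 := by positivity
  rw [columnProb_eq_Q_div hm hk, one_sub_div hpow, div_div_div_cancel_right₀ hpow]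

variable {V : Type*} [DecidableEq V] (p : List V)

theorem card_unrepeated_multiplicity : Fintype.card (Unrepeated (multiplicity p)) =
    (p.toFinset.filter fun v => p.count v = 1).card := by
  rw [← Finset.card_univ]
  refine Finset.card_bij (fun v _ => v.1.1) (fun v _ => ?_)
    (fun _ _ _ _ h => Subtype.ext (Subtype.ext h)) fun v hv => ?_
  · have count_pos : 0 < p.count v.1.1 := List.count_pos_iff.2 v.1.2
    have count_lt : ¬ 2 ≤ p.count v.1.1 := v.2
    exact Finset.mem_filter.2 ⟨List.mem_toFinset.2 v.1.2, by omega⟩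
  · obtain ⟨hp, hcount⟩ := Finset.mem_filter.1 hv
    exact ⟨⟨⟨v, List.mem_toFinset.1 hp⟩, (by omega : ¬ 2 ≤ p.count v)⟩, Finset.mem_univ _, rfl⟩

theorem prod_repeated_multiplicity {M : Type*} [CommMonoid M] (f : ℕ → M) :
    ∏ v : Repeated (multiplicity p), f (multiplicity p v) =
      ∏ v ∈ p.toFinset.filter (fun v => 2 ≤ p.count v), f (p.count v) := by
  refine Finset.prod_bij (fun v _ => v.1.1) (fun v _ => ?_)
    (fun _ _ _ _ h => Subtype.ext (Subtype.ext h)) (fun v hv => ?_) fun _ _ => rfl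
  · exact Finset.mem_filter.2 ⟨List.mem_toFinset.2 v.1.2, v.2⟩
  · obtain ⟨hp, hcount⟩ := Finset.mem_filter.1 hv
    exact ⟨⟨⟨v, List.mem_toFinset.1 hp⟩, hcount⟩, Finset.mem_univ _, rfl⟩

theorem prod_columnProb_multiplicity {m : ℕ} (hm : m ≠ 0) (d : ℝ) :
    ∏ v : Repeated (multiplicity p),
        columnProb m d (multiplicity p v) / (1 - columnProb m d (multiplicity p v)) =
      ∏ v ∈ p.toFinset.filter (fun v => 2 ≤ p.count v),
        Q m d (p.count v) / ((m : ℝ) ^ (p.count v - 1) - Q m d (p.count v)) := by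
  rw [prod_repeated_multiplicity p fun k => columnProb m d k / (1 - columnProb m d k)]
  refine Finset.prod_congr rfl fun v hv => columnProb_div_one_sub hm ?_
  exact one_le_two.trans (Finset.mem_filter.1 hv).2

variable {p}

theorem columnProb_multiplicity_lt_one {m : ℕ} {d : ℝ} (hm : 2 ≤ m ∨ (m = 1 ∧ p.Nodup))
    (hd0 : 0 < d) (hd1 : d < 1) (v : Repeated (multiplicity p)) :
    columnProb m d (multiplicity p v) < 1 := by
  obtain hm | ⟨-, hp⟩ := hm
  · exact columnProb_lt_one hm v.2 hd0 hd1
  · exact absurd (List.nodup_iff_count_le_one.1 hp v.1.1) (not_le.2 v.2)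

theorem tendsto_meanOccurrences_div_pow {A : Type*} [Fintype A] [Nonempty A] {d : ℚ}
    {F : Filter ℕ} {K : ℕ → ℕ} (hF : F ≤ atTop) (hK : ∀ᶠ n in F, (K n : ℚ) = d * n) (hd0 : 0 < d)
    (hd1 : d < 1)
    (hq : ∀ v : Repeated (multiplicity p), columnProb (Fintype.card A) d (multiplicity p v) < 1) :
    Tendsto (fun n => meanOccurrences p A n d /
        (n : ℝ) ^ (Fintype.card (Unrepeated (multiplicity p)) + 1)) F
      (nhds ((∏ v : Repeated (multiplicity p), columnProb (Fintype.card A) d (multiplicity p v) /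
        (1 - columnProb (Fintype.card A) d (multiplicity p v))) *
          (1 / ((Fintype.card (Unrepeated (multiplicity p)) + 1)! : ℝ)))) := by
  have hKR : ∀ᶠ n in F, (K n : ℝ) = (d : ℝ) * n := hK.mono fun n hn => by exact_mod_cast hn
  refine (tendsto_tsum_compatProb hF hKR (Rat.cast_pos.2 hd0) (by exact_mod_cast hd1) hq
    _).congr' ?_
  filter_upwards [hK, hKR, hF (eventually_gt_atTop 0)] with n hn hnR hn0
  rw [meanOccurrences_eq_tsum p hn0 hn (natCast_le_of_eq_mul hnR (by exact_mod_cast hd1.le)),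
    ← tsum_div_const]
  exact tsum_congr fun l => (mul_div_assoc _ _ _).symm

theorem isEquivalent_meanOccurrences {A : Type*} [Fintype A] [Nonempty A] {d : ℚ}
    {F : Filter ℕ} {K : ℕ → ℕ} (hF : F ≤ atTop) (hK : ∀ᶠ n in F, (K n : ℚ) = d * n) (hd0 : 0 < d)
    (hd1 : d < 1)
    (hq : ∀ v : Repeated (multiplicity p), columnProb (Fintype.card A) d (multiplicity p v) < 1) :
    (fun n => meanOccurrences p A n d) ~[F] fun n =>
      (n : ℝ) ^ (Fintype.card (Unrepeated (multiplicity p)) + 1) *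
        ((∏ v : Repeated (multiplicity p), columnProb (Fintype.card A) d (multiplicity p v) /
          (1 - columnProb (Fintype.card A) d (multiplicity p v))) *
            (1 / ((Fintype.card (Unrepeated (multiplicity p)) + 1)! : ℝ))) := by
  have prod_pos : 0 < ∏ v : Repeated (multiplicity p), columnProb (Fintype.card A) d
      (multiplicity p v) / (1 - columnProb (Fintype.card A) d (multiplicity p v)) :=
    Finset.prod_pos fun v _ => div_pos
      (columnProb_pos Fintype.card_pos (Rat.cast_pos.2 hd0) (by exact_mod_cast hd1.le))
      (sub_pos.2 (hq v))
  refine isEquivalent_mul_const_of_tendsto_div (by positivity) (hF ?_)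
    (tendsto_meanOccurrences_div_pow hF hK hd0 hd1 hq)
  exact (eventually_ne_atTop 0).mono fun n hn => pow_ne_zero _ (Nat.cast_ne_zero.2 hn)

theorem eventually_natFloor_eq_mul (d : ℚ) :
    ∀ᶠ n : ℕ in atTop ⊓ 𝓟 {n : ℕ | ∃ h : ℕ, (h : ℚ) = d * n}, (⌊d * n⌋₊ : ℚ) = d * n := by
  refine eventually_inf_principal.2 (.of_forall ?_)
  rintro n ⟨h, hh⟩
  rw [← hh, Nat.floor_natCast]

end MeanOccurrencesLimit

end PartialWord

theorem mainTheorem8 {V : Type*} [DecidableEq V] {A : Type*} [Fintype A]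
    (p : List V) (m s : ℕ) (hA : Fintype.card A = m)
    (hm : 2 ≤ m ∨ (m = 1 ∧ p.Nodup))
    (hs : s = (p.toFinset.filter fun v => p.count v = 1).card)
    (d : ℚ) (hd0 : 0 < d) (hd1 : d < 1) :
    (fun n : ℕ => PartialWord.meanOccurrences p A n d)
      ~[atTop ⊓ 𝓟 {n : ℕ | ∃ h : ℕ, (h : ℚ) = d * n}]
    (fun n : ℕ => (n : ℝ) ^ (s + 1) / ((s + 1)! : ℝ) *
      ∏ v ∈ p.toFinset.filter (fun v => 2 ≤ p.count v),
        PartialWord.Q m d (p.count v) /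
          ((m : ℝ) ^ (p.count v - 1) - PartialWord.Q m d (p.count v))) := by
  subst hA hs
  have : Nonempty A := Fintype.card_pos_iff.1 (by omega)
  have hq := PartialWord.columnProb_multiplicity_lt_one (d := d) hm (Rat.cast_pos.2 hd0)
    (by exact_mod_cast hd1)
  have asymptotic := PartialWord.isEquivalent_meanOccurrences inf_le_left
    (PartialWord.eventually_natFloor_eq_mul d) hd0 hd1 hq
  rw [PartialWord.prod_columnProb_multiplicity p Fintype.card_ne_zero,
    PartialWord.card_unrepeated_multiplicity] at asymptotic
  refine asymptotic.congr_right (.of_forall fun n => ?_)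
  ring
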